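/- The isolation game on a finite simple graph $G$ is played by Dominator and Staller, who alternately select vertices of $G$. Write $N_G[x]$ for the closed neighbourhood of a vertex $x$, and $N_G[X]=\bigcup_{x\in X}N_G[x]$. If $X$ is the set of vertices already selected, a vertex $x$ may be selected only if $N_G[x]$ contains a vertex of a nontrivial component (a component with at least two vertices) of the graph $G-N_G[X]$. The game ends when no such vertex exists. Dominator wants to minimize, and Staller to maximize, the total number of selected vertices. Let $\iota_{\rm g}(G)$ and $\iota_{\rm g}'(G)$ be the number of vertices selected under optimal play by both players when Dominator, respectively Staller, makes the first move. Theorem. For every integer $n\ge 1$, the path $P_n$ on $n$ vertices satisfies $$\iota_{\rm g}(P_n)=\begin{cases}\left\lfloor\frac{2n+1}{5}\right\rfloor-1, & n\equiv 0 \pmod 5,\\[1mm] \left\lfloor\frac{2n+1}{5}\right\rfloor, & \text{otherwise,}\end{cases}\qquad\text{and}\qquad \iota_{\rm g}'(P_n)=\left\lfloor\frac{2n+2}{5}\right\rfloor .$$ -/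

import Mathlib

namespace IsolationGame

variable {V : Type*}

/-- The closed neighbourhood `N_G[x]`: the vertex `x` together with its neighbours.
A vertex `x` dominates exactly the vertices of `N_G[x]`. -/
def closedNbhd (G : SimpleGraph V) (x : V) : Set V :=
  insert x (G.neighborSet x)

/-- The closed neighbourhood `N_G[X]` of a set `X` of vertices. -/
def closedNbhdSet (G : SimpleGraph V) (X : Set V) : Set V :=
  ⋃ x ∈ X, closedNbhd G x

/-- The graph `G - N_G[X]`. -/
abbrev residual (G : SimpleGraph V) (X : Set V) : SimpleGraph ↥(closedNbhdSet G X)ᶜ :=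
  G.induce (closedNbhdSet G X)ᶜ

/-- When `X` is the set of vertices already played, `x` is playable if it dominates a vertex
that belongs to a nontrivial component (one with at least two vertices) of `G - N_G[X]`. -/
def Playable (G : SimpleGraph V) (X : Set V) (x : V) : Prop :=
  ∃ C : (residual G X).ConnectedComponent,
    C.supp.Nontrivial ∧ ∃ v ∈ C.supp, (v : V) ∈ closedNbhd G x

/-- An already played vertex is never playable. -/
theorem Playable.notMem {G : SimpleGraph V} {X : Set V} {x : V} (h : Playable G X x) :
    x ∉ X := by
  obtain ⟨C, -, v, -, hv⟩ := h
  exact fun hx => v.2 (Set.mem_biUnion hx hv)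

/-- The finite set of playable vertices when `X` is the set of vertices already played. -/
noncomputable def playableFinset [Fintype V] (G : SimpleGraph V) (X : Finset V) : Finset V :=
  open Classical in Finset.univ.filter (Playable G (X : Set V))

theorem mem_playableFinset [Fintype V] {G : SimpleGraph V} {X : Finset V} {x : V} :
    x ∈ playableFinset G X ↔ Playable G (X : Set V) x := by
  simp [playableFinset]

/-- The two players: Dominator minimizes and Staller maximizes the number of moves. -/
inductive Player where
  | dominator
  | staller

/-- The number of moves still to be made under optimal play, when `X` is the set of vertices
already played and the given player is to move.  The game is over when no vertex is playable. -/
noncomputable def movesLeft [Fintype V] [DecidableEq V] (G : SimpleGraph V) :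
    Player → Finset V → ℕ
  | .dominator, X =>
      if h : (playableFinset G X).attach.Nonempty then
        (playableFinset G X).attach.inf' h
          (fun x => movesLeft G .staller (insert x.1 X)) + 1
      else 0
  | .staller, X =>
      if h : (playableFinset G X).attach.Nonempty then
        (playableFinset G X).attach.sup' h
          (fun x => movesLeft G .dominator (insert x.1 X)) + 1
      else 0
termination_by _ X => Xᶜ.card
decreasing_by
  all_goals
    have hx := (mem_playableFinset.1 x.2).notMem
    refine Finset.card_lt_card (Finset.compl_ssubset_compl.2 (Finset.ssubset_insert ?_))
    simpa using hx

/-- The game isolation number `ι_g(G)`: Dominator makes the first move. -/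
noncomputable def gameIsolationNumber [Fintype V] [DecidableEq V] (G : SimpleGraph V) : ℕ :=
  movesLeft G .dominator ∅

/-- The Staller-start game isolation number `ι_g'(G)`: Staller makes the first move. -/
noncomputable def stallerStartGameIsolationNumber [Fintype V] [DecidableEq V]
    (G : SimpleGraph V) : ℕ :=
  movesLeft G .staller ∅

end IsolationGame

namespace IsolationGame

open SimpleGraph

/-! ### Minimax characterisation of the two values -/

section OptimalPlay

variable {V : Type*} [Fintype V] [DecidableEq V] {G : SimpleGraph V} {X : Finset V}

/-! The undominated vertices of a path form runs far enough apart that each move affects only one,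
so a position is a sum of runs. A run of length k gets weight w(k), with w(1), ..., w(5) = 0, 8, 12,
14, 15 and w(k+5) = w(k) + 16 for k ≥ 1. If W is the total weight, ⌊W/8⌋ moves remain with Dominator
to move and ⌈W/8⌉ with Staller to move (`movesLeft_eq`).

Every move lowers W by at least 1 and at most 15 (`weight_move`), so neither player can beat these
values. Both are attained in a run whose weight is no more divisible by 2 than W is
(`exists_good_run`): Dominator in effect shortens it by four, Staller by one.

Staller's reply uses a vertex just outside the run, which is missing only if the run is the whole
path. Staller's opening move is therefore optimised directly. -/

theorem movesLeft_eq_zero (p : Player) (h : ∀ x, ¬ Playable G (X : Set V) x) :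
    movesLeft G p X = 0 := by
  have h' : ¬ (playableFinset G X).attach.Nonempty := by
    rintro ⟨x, -⟩
    exact h x.1 (mem_playableFinset.1 x.2)
  cases p <;> rw [movesLeft, dif_neg h']

theorem movesLeft_dominator_eq {m : ℕ}
    (hex : ∃ x, Playable G (X : Set V) x ∧ movesLeft G .staller (insert x X) ≤ m)
    (hall : ∀ x, Playable G (X : Set V) x → m ≤ movesLeft G .staller (insert x X)) :
    movesLeft G .dominator X = m + 1 := by
  obtain ⟨x, hx, hxm⟩ := hex
  have hne : (playableFinset G X).attach.Nonempty :=
    ⟨⟨x, mem_playableFinset.2 hx⟩, Finset.mem_attach _ _⟩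
  rw [movesLeft, dif_pos hne]
  congr 1
  refine le_antisymm ?_ ?_
  · exact (Finset.inf'_le (fun x : {x // x ∈ playableFinset G X} =>
      movesLeft G .staller (insert x.1 X))
      (Finset.mem_attach _ ⟨x, mem_playableFinset.2 hx⟩)).trans hxm
  · exact Finset.le_inf' _ _ fun y _ => hall y.1 (mem_playableFinset.1 y.2)

theorem movesLeft_staller_eq {m : ℕ}
    (hex : ∃ x, Playable G (X : Set V) x ∧ m ≤ movesLeft G .dominator (insert x X))
    (hall : ∀ x, Playable G (X : Set V) x → movesLeft G .dominator (insert x X) ≤ m) :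
    movesLeft G .staller X = m + 1 := by
  obtain ⟨x, hx, hxm⟩ := hex
  have hne : (playableFinset G X).attach.Nonempty :=
    ⟨⟨x, mem_playableFinset.2 hx⟩, Finset.mem_attach _ _⟩
  rw [movesLeft, dif_pos hne]
  congr 1
  refine le_antisymm ?_ ?_
  · exact Finset.sup'_le _ _ fun y _ => hall y.1 (mem_playableFinset.1 y.2)
  · exact hxm.trans (Finset.le_sup' (fun x : {x // x ∈ playableFinset G X} =>
      movesLeft G .dominator (insert x.1 X))
      (Finset.mem_attach _ ⟨x, mem_playableFinset.2 hx⟩))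

end OptimalPlay

/-! ### Playability in terms of undominated edges -/

theorem mem_closedNbhd {V : Type*} {G : SimpleGraph V} {x v : V} :
    v ∈ closedNbhd G x ↔ v = x ∨ G.Adj x v := Iff.rfl

/-- A vertex is playable exactly when it dominates an endpoint of an undominated edge. -/
theorem playable_iff {V : Type*} {G : SimpleGraph V} {X : Set V} {x : V} :
    Playable G X x ↔ ∃ v u, v ∉ closedNbhdSet G X ∧ u ∉ closedNbhdSet G X ∧
      G.Adj v u ∧ v ∈ closedNbhd G x := by
  constructor
  · rintro ⟨C, hC, v, hv, hvx⟩
    obtain ⟨u, hu, huv⟩ := hC.exists_ne v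
    have hr : (residual G X).Reachable v u :=
      ConnectedComponent.exact (((ConnectedComponent.mem_supp_iff _ _).1 hv).trans
        ((ConnectedComponent.mem_supp_iff _ _).1 hu).symm)
    obtain ⟨p⟩ := hr
    cases p with
    | nil => exact absurd rfl huv
    | @cons _ t _ h _ => exact ⟨v, t, v.2, t.2, h, hvx⟩
  · rintro ⟨v, u, hv, hu, hvu, hvx⟩
    have hadj : (residual G X).Adj ⟨v, hv⟩ ⟨u, hu⟩ := hvu
    refine ⟨(residual G X).connectedComponentMk ⟨v, hv⟩,
      ⟨⟨v, hv⟩, rfl, ⟨u, hu⟩, ConnectedComponent.sound hadj.symm.reachable, ?_⟩, ⟨v, hv⟩, rfl, hvx⟩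
    exact fun h => hvu.ne (congrArg Subtype.val h)

theorem closedNbhdSet_insert {V : Type*} (G : SimpleGraph V) (x : V) (X : Set V) :
    closedNbhdSet G (insert x X) = closedNbhd G x ∪ closedNbhdSet G X := by
  simp [closedNbhdSet]

theorem mem_closedNbhd_pathGraph {n : ℕ} {x v : Fin n} :
    v ∈ closedNbhd (pathGraph n) x ↔ (v : ℕ) ≤ x + 1 ∧ (x : ℕ) ≤ v + 1 := by
  rw [mem_closedNbhd, pathGraph_adj, Fin.ext_iff]
  omega

/-! ### Positions on a path as lists of undominated runs -/

/-- A pair `(a, k)` stands for the run `a, a + 1, …, a + k - 1`.  Two nonempty runs are separated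
when at least two vertices lie between them. -/
def Separated (p q : ℕ × ℕ) : Prop :=
  p.2 = 0 ∨ q.2 = 0 ∨ p.1 + p.2 + 2 ≤ q.1 ∨ q.1 + q.2 + 2 ≤ p.1

instance : Std.Symm Separated where
  symm p q h := by
    unfold Separated at *
    omega

/-- The undominated vertices of the path, when `X` has been played, form the separated runs
listed in `L`. -/
structure HasRuns {n : ℕ} (X : Finset (Fin n)) (L : List (ℕ × ℕ)) : Prop where
  notMem_iff : ∀ v : Fin n, v ∉ closedNbhdSet (pathGraph n) (X : Set (Fin n)) ↔
    ∃ p ∈ L, p.1 ≤ v ∧ (v : ℕ) < p.1 + p.2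
  le : ∀ p ∈ L, 0 < p.2 → p.1 + p.2 ≤ n
  separated : L.Pairwise Separated

/-- No run in `L` is the whole path on `n` vertices. -/
def HasOuterNeighbors (n : ℕ) (L : List (ℕ × ℕ)) : Prop :=
  ∀ p ∈ L, 1 ≤ p.1 ∨ p.1 + p.2 < n

/-- Playing `x` dominates at least one vertex of the run `p`. -/
def Meets (x : ℕ) (p : ℕ × ℕ) : Prop :=
  p.1 ≤ x + 1 ∧ x ≤ p.1 + p.2

/-- The part of a run left of the closed neighbourhood of `x`. -/
def leftPart (p : ℕ × ℕ) (x : ℕ) : ℕ × ℕ := (p.1, x - 1 - p.1)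

/-- The part of a run right of the closed neighbourhood of `x`. -/
def rightPart (p : ℕ × ℕ) (x : ℕ) : ℕ × ℕ := (x + 2, p.1 + p.2 - (x + 2))

section Runs

variable {n : ℕ} {X : Finset (Fin n)} {L : List (ℕ × ℕ)}

theorem HasRuns.perm {L' : List (ℕ × ℕ)} (h : HasRuns X L) (hL : L.Perm L') : HasRuns X L' where
  notMem_iff v := by simp only [h.notMem_iff v, hL.mem_iff]
  le p hp := h.le p (hL.mem_iff.2 hp)
  separated := (hL.pairwise_iff fun h => symm h).1 h.separated

theorem hasRuns_empty (n : ℕ) : HasRuns (∅ : Finset (Fin n)) [(0, n)] where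
  notMem_iff v := by simp [closedNbhdSet]
  le p hp := by simp_all
  separated := List.pairwise_singleton _ _

theorem HasRuns.playable_iff (h : HasRuns X L) {x : Fin n} :
    Playable (pathGraph n) (X : Set (Fin n)) x ↔ ∃ p ∈ L, 2 ≤ p.2 ∧ Meets x p := by
  rw [IsolationGame.playable_iff]
  simp only [h.notMem_iff, mem_closedNbhd_pathGraph, pathGraph_adj, Meets]
  constructor
  · rintro ⟨v, u, ⟨p, hp, hpv⟩, ⟨q, hq, hqu⟩, hvu, hvx⟩
    have hpq : p = q := by
      by_contra hne
      have hsep := h.separated.forall hp hq hne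
      unfold Separated at hsep
      omega
    subst hpq
    exact ⟨p, hp, by omega, by omega⟩
  · rintro ⟨p, hp, hp2, hx⟩
    have hn := h.le p hp (by omega)
    have hxn := x.2
    have key : ∃ v u : ℕ, (p.1 ≤ v ∧ v < p.1 + p.2) ∧ (p.1 ≤ u ∧ u < p.1 + p.2) ∧
        (v + 1 = u ∨ u + 1 = v) ∧ (v ≤ x + 1 ∧ (x : ℕ) ≤ v + 1) := by
      by_cases h1 : (x : ℕ) ≤ p.1
      · exact ⟨p.1, p.1 + 1, by omega, by omega, by omega, by omega⟩
      -- The vertex `x - 1` lies in the run. Its partner is `x`, unless `x` is just past the right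
      -- end, when it is `x - 2`.
      · exact ⟨x - 1, if (x : ℕ) = p.1 + p.2 then x - 2 else x, by omega, by split_ifs <;> omega,
          by split_ifs <;> omega, by omega⟩
    obtain ⟨v, u, hv, hu, hvu, hvx⟩ := key
    exact ⟨⟨v, by omega⟩, ⟨u, by omega⟩, ⟨p, hp, hv⟩, ⟨p, hp, hu⟩, hvu, hvx⟩

/-- A closed neighbourhood spans three consecutive vertices, so a gap of two keeps it from meeting a
second nonempty run. Truncated subtraction makes a part empty when `x` is at or beside an end. -/
theorem HasRuns.insert {p : ℕ × ℕ} {x : Fin n} (h : HasRuns X (p :: L)) (hp : 0 < p.2)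
    (hx : Meets x p) : HasRuns (insert x X) (leftPart p x :: rightPart p x :: L) := by
  have hsep := List.pairwise_cons.1 h.separated
  have hn := h.le p (by simp) hp
  unfold Meets at hx
  refine ⟨fun v => ?_, ?_, ?_⟩
  · have hv := h.notMem_iff v
    rw [Finset.coe_insert, closedNbhdSet_insert, Set.mem_union, not_or, hv,
      mem_closedNbhd_pathGraph]
    simp only [List.mem_cons, exists_eq_or_imp, leftPart, rightPart]
    constructor
    · rintro ⟨hvx, hvp | hvq⟩
      · by_cases hlt : (v : ℕ) < x
        · left; omega
        · right; left; omega
      · exact Or.inr (Or.inr hvq)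
    · rintro (hl | hr | ⟨q, hq, hqv⟩)
      · exact ⟨by omega, Or.inl (by omega)⟩
      · exact ⟨by omega, Or.inl (by omega)⟩
      · refine ⟨?_, Or.inr ⟨q, hq, hqv⟩⟩
        have := hsep.1 q hq
        unfold Separated at this
        omega
  · simp only [List.mem_cons, forall_eq_or_imp, leftPart, rightPart]
    exact ⟨by omega, by omega, fun q hq => h.le q (by simp [hq])⟩
  · have hsub : ∀ q ∈ L, Separated (leftPart p x) q ∧ Separated (rightPart p x) q := by
      intro q hq
      have := hsep.1 q hq
      unfold Separated leftPart rightPart at *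
      dsimp only
      omega
    refine List.pairwise_cons.2 ⟨?_, List.pairwise_cons.2 ⟨fun q hq => (hsub q hq).2, hsep.2⟩⟩
    intro q hq
    rcases List.mem_cons.1 hq with rfl | hq
    · unfold Separated leftPart rightPart
      dsimp only
      omega
    · exact (hsub q hq).1

/-- Both new runs avoid `x`, so even if `p` is the whole path the exception disappears after one
move. -/
theorem HasOuterNeighbors.move {p : ℕ × ℕ} {x : Fin n} (h : HasOuterNeighbors n L) :
    HasOuterNeighbors n (leftPart p x :: rightPart p x :: L) := by
  have hx := x.2
  simp only [HasOuterNeighbors, List.mem_cons, forall_eq_or_imp, leftPart, rightPart]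
  exact ⟨by omega, by omega, h⟩

end Runs

/-! ### Weights -/

/-- Eight times the contribution of a run of length `k` to the number of moves left. -/
def weight (k : ℕ) : ℕ :=
  16 * ((k - 1) / 5) + (16 - 16 / 2 ^ ((k - 1) % 5))

/-- The total weight of a list of runs. -/
def totalWeight (L : List (ℕ × ℕ)) : ℕ := (L.map fun p => weight p.2).sum

theorem totalWeight_cons (p : ℕ × ℕ) (L : List (ℕ × ℕ)) :
    totalWeight (p :: L) = weight p.2 + totalWeight L := by
  simp [totalWeight]

theorem totalWeight_perm {L L' : List (ℕ × ℕ)} (h : L.Perm L') :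
    totalWeight L = totalWeight L' :=
  (h.map _).sum_eq

/-- Makes the weight linear on each residue class, in a form `omega` can use. -/
theorem weight_cases (k : ℕ) : (k = 0 ∧ weight k = 0) ∨ ∃ q,
    (k = 5 * q + 1 ∧ weight k = 16 * q) ∨ (k = 5 * q + 2 ∧ weight k = 16 * q + 8) ∨
    (k = 5 * q + 3 ∧ weight k = 16 * q + 12) ∨ (k = 5 * q + 4 ∧ weight k = 16 * q + 14) ∨
    (k = 5 * q + 5 ∧ weight k = 16 * q + 15) := by
  rcases Nat.eq_zero_or_pos k with rfl | hk
  · exact Or.inl ⟨rfl, rfl⟩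
  · refine Or.inr ⟨(k - 1) / 5, ?_⟩
    have hr : (k - 1) % 5 < 5 := Nat.mod_lt _ (by norm_num)
    have hw : weight k = 16 * ((k - 1) / 5) + (16 - 16 / 2 ^ ((k - 1) % 5)) := rfl
    generalize hr' : (k - 1) % 5 = r at *
    interval_cases r <;> norm_num at hw <;> omega

/-- The weight left of a run of length `k` after a move into it. -/
theorem weight_move {p : ℕ × ℕ} {x : ℕ} (hp : 2 ≤ p.2) (hx : Meets x p) :
    weight (leftPart p x).2 + weight (rightPart p x).2 + 1 ≤ weight p.2 ∧
      weight p.2 ≤ weight (leftPart p x).2 + weight (rightPart p x).2 + 15 := by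
  unfold Meets at hx
  simp only [leftPart, rightPart]
  generalize hl : x - 1 - p.1 = l
  generalize hr : p.1 + p.2 - (x + 2) = r
  -- A move removes three vertices from inside the run, or two or one at an end.
  have hsum : (l + r + 3 = p.2) ∨ (l = 0 ∧ (r + 2 = p.2 ∨ r + 1 = p.2)) ∨
      (r = 0 ∧ (l + 2 = p.2 ∨ l + 1 = p.2)) := by omega
  generalize p.2 = k at *
  clear hl hr hx
  have h0 : weight 0 = 0 := rfl
  obtain ⟨q, hk⟩ := (weight_cases k).resolve_left (by omega)
  rcases hsum with h | ⟨rfl, h⟩ | ⟨rfl, h⟩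
  · rcases weight_cases l with hl | ⟨s, hl | hl | hl | hl | hl⟩ <;>
    rcases weight_cases r with hr | ⟨t, hr | hr | hr | hr | hr⟩ <;>
    omega
  · rcases weight_cases r with hr | ⟨t, hr⟩ <;> omega
  · rcases weight_cases l with hl | ⟨s, hl⟩ <;> omega

theorem two_le_length_of_weight {k : ℕ} (h : 0 < weight k) : 2 ≤ k := by
  rcases weight_cases k with hk | ⟨q, hk⟩ <;> omega

/-- If no run is playable, the total weight vanishes. -/
theorem totalWeight_eq_zero {L : List (ℕ × ℕ)} (h : ∀ p ∈ L, p.2 < 2) : totalWeight L = 0 := by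
  refine List.sum_eq_zero fun w hw => ?_
  obtain ⟨p, hp, rfl⟩ := List.mem_map.1 hw
  have := h p hp
  by_contra hne
  have := two_le_length_of_weight (Nat.pos_of_ne_zero hne)
  omega

/-- In a playable position some run allows Dominator, respectively Staller, to change the total
weight as much, respectively as little, as the fractional part of one eighth of the total weight
demands. -/
theorem exists_good_run {L : List (ℕ × ℕ)} (h : ∃ p ∈ L, 2 ≤ p.2) :
    ∃ p ∈ L, 2 ≤ p.2 ∧
      weight (p.2 - 4) + 8 + totalWeight L % 8 ≤ weight p.2 ∧
      (totalWeight L % 8 = 0 ∧ weight p.2 ≤ weight (p.2 - 1) + 8 ∨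
        weight p.2 ≤ weight (p.2 - 1) + totalWeight L % 8) := by
  -- Contrapositively, if `d` does not divide the total, it fails to divide some single weight,
  -- which restricts that run's length modulo 5.
  have key (d : ℕ) (hd : ∀ p ∈ L, d ∣ weight p.2) : d ∣ totalWeight L :=
    List.dvd_sum fun w hw => by
      obtain ⟨p, hp, rfl⟩ := List.mem_map.1 hw
      exact hd p hp
  have hlt := Nat.mod_lt (totalWeight L) (show 0 < 8 by norm_num)
  by_cases h2 : 2 ∣ totalWeight L
  · by_cases h4 : 4 ∣ totalWeight L
    · by_cases h8 : 8 ∣ totalWeight L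
      -- Any playable run works: shortening by four costs at least 8, by one at most 8.
      · obtain ⟨p, hp, hp2⟩ := h
        refine ⟨p, hp, hp2, ?_⟩
        rcases weight_cases p.2 with hk | ⟨q, hk⟩ <;>
        rcases weight_cases (p.2 - 4) with hl | ⟨s, hl⟩ <;>
        rcases weight_cases (p.2 - 1) with hr | ⟨t, hr⟩ <;> omega
      · obtain ⟨p, hp, hpd⟩ : ∃ p ∈ L, ¬ 8 ∣ weight p.2 := by
          by_contra! hall
          exact h8 (key 8 hall)
        rcases weight_cases p.2 with hk | ⟨q, hk⟩
        · omega
        refine ⟨p, hp, by omega, ?_⟩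
        rcases weight_cases (p.2 - 4) with hl | ⟨s, hl⟩ <;>
        rcases weight_cases (p.2 - 1) with hr | ⟨t, hr⟩ <;> omega
    · obtain ⟨p, hp, hpd⟩ : ∃ p ∈ L, ¬ 4 ∣ weight p.2 := by
        by_contra! hall
        exact h4 (key 4 hall)
      rcases weight_cases p.2 with hk | ⟨q, hk⟩
      · omega
      refine ⟨p, hp, by omega, ?_⟩
      rcases weight_cases (p.2 - 4) with hl | ⟨s, hl⟩ <;>
      rcases weight_cases (p.2 - 1) with hr | ⟨t, hr⟩ <;> omega
  · obtain ⟨p, hp, hpd⟩ : ∃ p ∈ L, ¬ 2 ∣ weight p.2 := by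
      by_contra! hall
      exact h2 (key 2 hall)
    rcases weight_cases p.2 with hk | ⟨q, hk⟩
    · omega
    refine ⟨p, hp, by omega, ?_⟩
    rcases weight_cases (p.2 - 4) with hl | ⟨s, hl⟩ <;>
    rcases weight_cases (p.2 - 1) with hr | ⟨t, hr⟩ <;> omega

/-- Dominator's best move in a run of length at least two. -/
theorem dominator_move {p : ℕ × ℕ} (hp : 2 ≤ p.2) :
    ∃ x, Meets x p ∧ p.1 ≤ x ∧ x < p.1 + p.2 ∧
      weight (leftPart p x).2 + weight (rightPart p x).2 = weight (p.2 - 4) := by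
  unfold Meets leftPart rightPart
  have h0 : weight 0 = 0 := rfl
  have h1 : weight 1 = 0 := rfl
  by_cases h : p.2 ≤ 3
  · refine ⟨p.1 + 1, by omega, by omega, by omega, ?_⟩
    dsimp only
    rw [show p.1 + 1 - 1 - p.1 = 0 by omega, show p.1 + p.2 - (p.1 + 1 + 2) = 0 by omega,
      show p.2 - 4 = 0 by omega, h0]
  -- The vertex cut off on the left is isolated and weighs 0, so four vertices are lost.
  · refine ⟨p.1 + 2, by omega, by omega, by omega, ?_⟩
    dsimp only
    rw [show p.1 + 2 - 1 - p.1 = 1 by omega, show p.1 + p.2 - (p.1 + 2 + 2) = p.2 - 4 by omega,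
      h1, zero_add]

/-- Staller shortens a run by one vertex. -/
theorem staller_move {n : ℕ} {p : ℕ × ℕ} (hp : 2 ≤ p.2) (hn : p.1 + p.2 ≤ n)
    (h : 1 ≤ p.1 ∨ p.1 + p.2 < n) :
    ∃ x < n, Meets x p ∧
      weight (leftPart p x).2 + weight (rightPart p x).2 = weight (p.2 - 1) := by
  unfold Meets leftPart rightPart
  have h0 : weight 0 = 0 := rfl
  rcases h with h | h
  · refine ⟨p.1 - 1, by omega, by omega, ?_⟩
    dsimp only
    rw [show p.1 - 1 - 1 - p.1 = 0 by omega, show p.1 + p.2 - (p.1 - 1 + 2) = p.2 - 1 by omega,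
      h0, zero_add]
  · refine ⟨p.1 + p.2, by omega, by omega, ?_⟩
    dsimp only
    rw [show p.1 + p.2 - 1 - p.1 = p.2 - 1 by omega,
      show p.1 + p.2 - (p.1 + p.2 + 2) = 0 by omega, h0, add_zero]

/-! ### Values of positions -/

section Values

variable {n : ℕ} {X : Finset (Fin n)} {L : List (ℕ × ℕ)}

theorem totalWeight_erase {p : ℕ × ℕ} (hp : p ∈ L) :
    totalWeight L = weight p.2 + totalWeight (L.erase p) := by
  rw [totalWeight_perm (List.perm_cons_erase hp), totalWeight_cons]

/-- A drop of at most 15 suffices for the lower bound since ⌈(W - 15)/8⌉ = ⌊W/8⌋ - 1; a drop of at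
least 8 + W % 8 attains it. Dominator's move lies inside the run, so the whole path is allowed here.
-/
theorem dominator_value (h : HasRuns X L)
    (hS : ∀ (x : Fin n) (p : ℕ × ℕ), p ∈ L → 2 ≤ p.2 → Meets x p →
      movesLeft (pathGraph n) .staller (Insert.insert x X) =
        (totalWeight (leftPart p x :: rightPart p x :: L.erase p) + 7) / 8) :
    movesLeft (pathGraph n) .dominator X = totalWeight L / 8 := by
  by_cases hne : ∃ p ∈ L, 2 ≤ p.2
  · obtain ⟨p, hp, hp2, hpw, -⟩ := exists_good_run hne
    obtain ⟨x, hxp, hx1, hx2, hxw⟩ := dominator_move hp2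
    have hn := h.le p hp (by omega)
    have hw := totalWeight_erase hp
    have hge : 8 ≤ totalWeight L := by omega
    rw [movesLeft_dominator_eq (m := totalWeight L / 8 - 1)]
    · omega
    · refine ⟨⟨x, by omega⟩, h.playable_iff.2 ⟨p, hp, hp2, hxp⟩, ?_⟩
      rw [hS ⟨x, by omega⟩ p hp hp2 hxp, totalWeight_cons, totalWeight_cons]
      dsimp only
      omega
    · intro y hy
      obtain ⟨q, hq, hq2, hyq⟩ := h.playable_iff.1 hy
      rw [hS y q hq hq2 hyq, totalWeight_cons, totalWeight_cons]
      have hw := totalWeight_erase hq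
      have := weight_move hq2 hyq
      omega
  · push Not at hne
    rw [totalWeight_eq_zero hne, movesLeft_eq_zero]
    intro x hx
    obtain ⟨p, hp, hp2, -⟩ := h.playable_iff.1 hx
    have := hne p hp
    omega

/-- A drop of at least 1 gives the upper bound since ⌊(W - 1)/8⌋ = ⌈W/8⌉ - 1; it is attained by a
drop of at most W % 8, or at most 8 if 8 divides W. -/
theorem staller_value (h : HasRuns X L) (hL : HasOuterNeighbors n L)
    (hD : ∀ (x : Fin n) (p : ℕ × ℕ), p ∈ L → 2 ≤ p.2 → Meets x p →
      movesLeft (pathGraph n) .dominator (Insert.insert x X) =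
        totalWeight (leftPart p x :: rightPart p x :: L.erase p) / 8) :
    movesLeft (pathGraph n) .staller X = (totalWeight L + 7) / 8 := by
  by_cases hne : ∃ p ∈ L, 2 ≤ p.2
  · obtain ⟨p, hp, hp2, hpw, hpw'⟩ := exists_good_run hne
    have hn := h.le p hp (by omega)
    obtain ⟨x, hxn, hxp, hxw⟩ := staller_move hp2 hn (hL p hp)
    have hw := totalWeight_erase hp
    have hpos : 8 ≤ totalWeight L := by omega
    rw [movesLeft_staller_eq (m := (totalWeight L + 7) / 8 - 1)]
    · omega
    · refine ⟨⟨x, hxn⟩, h.playable_iff.2 ⟨p, hp, hp2, hxp⟩, ?_⟩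
      rw [hD ⟨x, hxn⟩ p hp hp2 hxp, totalWeight_cons, totalWeight_cons]
      dsimp only
      omega
    · intro y hy
      obtain ⟨q, hq, hq2, hyq⟩ := h.playable_iff.1 hy
      rw [hD y q hq hq2 hyq, totalWeight_cons, totalWeight_cons]
      have hw := totalWeight_erase hq
      have := weight_move hq2 hyq
      omega
  · push Not at hne
    rw [totalWeight_eq_zero hne, movesLeft_eq_zero]
    intro x hx
    obtain ⟨p, hp, hp2, -⟩ := h.playable_iff.1 hx
    have := hne p hp
    omega

/-- The value of a position in which no run is the whole path. -/
theorem movesLeft_eq (h : HasRuns X L) (hL : HasOuterNeighbors n L) :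
    movesLeft (pathGraph n) .dominator X = totalWeight L / 8 ∧
      movesLeft (pathGraph n) .staller X = (totalWeight L + 7) / 8 := by
  induction hc : Xᶜ.card using Nat.strong_induction_on generalizing X L with
  | _ c ih =>
    have key (x : Fin n) (p : ℕ × ℕ) (hp : p ∈ L) (hp2 : 2 ≤ p.2) (hxp : Meets x p) :=
      ih (Insert.insert x X)ᶜ.card (by
        have hx := (h.playable_iff.2 ⟨p, hp, hp2, hxp⟩).notMem
        rw [← hc]
        exact Finset.card_lt_card (Finset.compl_ssubset_compl.2 (Finset.ssubset_insert hx)))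
        ((h.perm (List.perm_cons_erase hp)).insert (by omega) hxp)
        (HasOuterNeighbors.move fun q hq => hL q (List.mem_of_mem_erase hq)) rfl
    exact ⟨dominator_value h fun x p hp hp2 hxp => (key x p hp hp2 hxp).2,
      staller_value h hL fun x p hp hp2 hxp => (key x p hp hp2 hxp).1⟩

/-- The value of a position reached by the first move on the path. -/
theorem movesLeft_first_move (x : Fin n) :
    movesLeft (pathGraph n) .dominator {x} =
        (weight (x - 1) + weight (n - (x + 2))) / 8 ∧
      movesLeft (pathGraph n) .staller {x} =
        (weight (x - 1) + weight (n - (x + 2)) + 7) / 8 := by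
  have hx := x.2
  have h := (hasRuns_empty n).insert (p := (0, n)) (x := x) (by dsimp only; omega)
    ⟨by dsimp only; omega, by dsimp only; omega⟩
  have := movesLeft_eq h (HasOuterNeighbors.move (by simp [HasOuterNeighbors]))
  simpa [totalWeight, leftPart, rightPart] using this

theorem playable_empty_iff {x : Fin n} :
    Playable (pathGraph n) ((∅ : Finset (Fin n)) : Set (Fin n)) x ↔ 2 ≤ n := by
  have hx := x.2
  rw [(hasRuns_empty n).playable_iff]
  simp only [List.mem_singleton, exists_eq_left, Meets]
  omega

theorem gameIsolationNumber_pathGraph (n : ℕ) :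
    gameIsolationNumber (pathGraph n) = weight n / 8 := by
  rw [gameIsolationNumber, dominator_value (hasRuns_empty n)]
  · simp [totalWeight]
  · intro x p hp _ _
    obtain rfl := List.mem_singleton.1 hp
    have := (movesLeft_first_move x).2
    simpa [totalWeight, leftPart, rightPart] using this

theorem stallerStartGameIsolationNumber_pathGraph (hn : 1 ≤ n) :
    stallerStartGameIsolationNumber (pathGraph n) = (2 * n + 2) / 5 := by
  rw [stallerStartGameIsolationNumber]
  by_cases hn2 : 2 ≤ n
  · rw [movesLeft_staller_eq (m := (2 * n + 2) / 5 - 1)]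
    · omega
    -- Opening at an end leaves length `n - 2`. For `n = 5q + 2` with `q ≥ 1` this weighs 16q - 1,
    -- just too little, whereas vertex 3 leaves lengths 2 and `n - 5` of total weight 16q.
    · by_cases hr : n % 5 = 2
      · refine ⟨⟨if n = 2 then 0 else 3, by split_ifs <;> omega⟩, playable_empty_iff.2 hn2, ?_⟩
        rw [insert_empty_eq, (movesLeft_first_move _).1]
        dsimp only
        split_ifs with h
        · subst h
          norm_num
        · have h2 : weight (3 - 1) = 8 := rfl
          rcases weight_cases (n - (3 + 2)) with hk | ⟨q, hk⟩ <;> omega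
      · refine ⟨⟨0, by omega⟩, playable_empty_iff.2 hn2, ?_⟩
        rw [insert_empty_eq, (movesLeft_first_move _).1]
        dsimp only
        have h0 : weight (0 - 1) = 0 := rfl
        rcases weight_cases (n - (0 + 2)) with hk | ⟨q, hk⟩ <;> omega
    · intro x _
      have hx := x.2
      rw [insert_empty_eq, (movesLeft_first_move x).1]
      generalize (x : ℕ) = y at hx
      have hsum : (y - 1) + (n - (y + 2)) + 3 = n ∨ (y - 1 = 0 ∧ n - (y + 2) + 2 = n) ∨
        (y - 1 + 2 = n ∧ n - (y + 2) = 0) := by omega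
      generalize y - 1 = l at *
      generalize n - (y + 2) = r at *
      rcases weight_cases l with hl | ⟨s, hl | hl | hl | hl | hl⟩ <;>
      rcases weight_cases r with hr | ⟨t, hr | hr | hr | hr | hr⟩ <;>
      omega
  · rw [movesLeft_eq_zero]
    · omega
    · intro x hx
      exact hn2 (playable_empty_iff.1 hx)

end Values

end IsolationGame

theorem theorem2p5 (n : ℕ) (hn : 1 ≤ n) :
    (IsolationGame.gameIsolationNumber (SimpleGraph.pathGraph n) : ℤ) =
        (if n ≡ 0 [MOD 5] then ⌊(2 * (n : ℚ) + 1) / 5⌋ - 1 else ⌊(2 * (n : ℚ) + 1) / 5⌋) ∧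
      (IsolationGame.stallerStartGameIsolationNumber (SimpleGraph.pathGraph n) : ℤ) =
        ⌊(2 * (n : ℚ) + 2) / 5⌋ := by
  rw [IsolationGame.gameIsolationNumber_pathGraph,
    IsolationGame.stallerStartGameIsolationNumber_pathGraph hn]
  have h1 : ⌊(2 * (n : ℚ) + 1) / 5⌋ = (2 * (n : ℤ) + 1) / 5 := by
    have := Rat.floor_intCast_div_natCast (2 * (n : ℤ) + 1) 5
    push_cast at this
    exact this
  have h2 : ⌊(2 * (n : ℚ) + 2) / 5⌋ = (2 * (n : ℤ) + 2) / 5 := by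
    have := Rat.floor_intCast_div_natCast (2 * (n : ℤ) + 2) 5
    push_cast at this
    exact this
  rw [h1, h2]
  refine ⟨?_, by push_cast; rfl⟩
  unfold Nat.ModEq
  -- The exceptional case is `n = 5q + 5`: weight 16q + 15 gives 2q + 1, one below ⌊(2n + 1)/5⌋ = 2q
  -- + 2.
  rcases IsolationGame.weight_cases n with hw | ⟨q, hw⟩ <;> split_ifs <;> omega
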